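/- Let $\lambda>0$ and $D>0$. For each $T>0$ let $\mathbf X$ be a homogeneous Poisson process of intensity $\lambda$ on $[0,T]$, that is, a random finite set of points of $[0,T]$ whose counting function $N$ satisfies $N(0)=0$ almost surely, has independent increments, and satisfies $\Pr[N(t+\tau)-N(t)=k]=e^{-\lambda\tau}(\lambda\tau)^k/k!$ for all $\tau\in[0,T]$, $t\in[0,T-\tau]$, $k\in\{0,1,\dots\}$. For a finite set $\mathbf x\subset[0,T]$ and a Lebesgue-measurable signal $\hat x\colon[0,T]\to\{0,1\}$, let $$d(\mathbf x,\hat x)=\begin{cases}\mu(\hat x^{-1}(1))/T,&\text{if }\mathbf x\subseteq\hat x^{-1}(1),\\ \infty,&\text{otherwise,}\end{cases}$$ where $\mu$ is Lebesgue measure. A code of rate $r\in\mathbb R$ (bits per second) on $[0,T]$ consists of a measurable encoder $f_T$ that maps finite subsets of $[0,T]$ to messages in $\{1,\dots,\lfloor 2^{Tr}\rfloor\}$ and a reconstructor $\phi_T$ that maps each message to a Lebesgue-measurable $\{0,1\}$-valued signal on $[0,T]$. The pair $(R,D)$ is achievable if for every $\epsilon>0$ there is $T_0>0$ such that for every $T>T_0$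 there is a code of rate $R+\epsilon$ on $[0,T]$ with $$\mathbb E\bigl[d(\mathbf X,\phi_T(f_T(\mathbf X)))\bigr]\le D+\epsilon .$$ Then there is a smallest $R\in\mathbb R$, denoted $R(D,\lambda)$, for which $(R,D)$ is achievable, and $$R(D,\lambda)=\begin{cases}-\lambda\log_2 D,&0<D<1,\\ 0,&D\ge 1.\end{cases}$$ -/

import Mathlib

open MeasureTheory ProbabilityTheory
open scoped ENNReal

namespace PoissonCovering

/-- A point pattern: a finite set of points in the interval `[0, T]`. -/
@[ext]
structure PointPattern (T : ℝ) where
  points : Set ℝ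
  finite : points.Finite
  subset : points ⊆ Set.Icc 0 T

namespace PointPattern

/-- The number of points of the pattern that lie in the set `B`. -/
noncomputable def count {T : ℝ} (x : PointPattern T) (B : Set ℝ) : ℕ :=
  (x.points ∩ B).ncard

/-- The counting function of the pattern: the number of points in `[0, t]`. -/
noncomputable def counting {T : ℝ} (x : PointPattern T) (t : ℝ) : ℕ :=
  x.count (Set.Icc 0 t)

/-- The usual σ-algebra on point patterns: the smallest one for which all the counts
`x ↦ x.count B`, with `B` a Borel set, are measurable. -/
noncomputable instance instMeasurableSpace (T : ℝ) : MeasurableSpace (PointPattern T) :=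
  ⨆ (B : Set ℝ) (_ : MeasurableSet B),
    MeasurableSpace.comap (fun x : PointPattern T => x.count B) ⊤

end PointPattern

/-- `X` is a homogeneous Poisson process of intensity `lam` on `[0, T]`: a random point pattern
whose counting function starts at `0`, has independent increments, and satisfies
`Pr[N(t + τ) - N(t) = k] = e^{-lam τ} (lam τ)^k / k!`. -/
structure IsPoissonProcess {Ω : Type*} [MeasurableSpace Ω] (P : Measure Ω) (lam T : ℝ)
    (X : Ω → PointPattern T) : Prop where
  measurable : Measurable X
  counting_zero : ∀ᵐ ω ∂P, (X ω).counting 0 = 0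
  indep_increments :
    HasIndepIncrements (fun (t : Set.Icc (0 : ℝ) T) ω => ((X ω).counting (t : ℝ) : ℝ)) P
  law_increments : ∀ t τ : ℝ, 0 ≤ t → 0 ≤ τ → t + τ ≤ T → ∀ k : ℕ,
    P {ω | (X ω).counting (t + τ) = (X ω).counting t + k} =
      ENNReal.ofReal (Real.exp (-(lam * τ)) * (lam * τ) ^ k / (k.factorial : ℝ))

/-- A `{0,1}`-valued Lebesgue-measurable signal on `[0, T]`.  Lebesgue measurability of a set is
`NullMeasurableSet` for the measure `volume`; since there are only two values, it is enough to
ask it of the set of times at which the value is `1`. -/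
structure Signal (T : ℝ) where
  val : Set.Icc (0 : ℝ) T → Fin 2
  measurable : NullMeasurableSet (Subtype.val '' (val ⁻¹' {1}) : Set ℝ) volume

/-- The set of times in `[0, T]` at which the signal is equal to `1`. -/
def Signal.selected {T : ℝ} (s : Signal T) : Set ℝ :=
  Subtype.val '' (s.val ⁻¹' {1})

open Classical in
/-- The covering distortion: the Lebesgue measure of the selected set divided by `T` if all the
points of the pattern are selected, and `∞` otherwise. -/
noncomputable def distortion {T : ℝ} (x : PointPattern T) (s : Signal T) : ℝ≥0∞ :=
  if x.points ⊆ s.selected then volume s.selected / ENNReal.ofReal T else ∞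

/-- A code of rate `r` bits per second on `[0, T]`: a (measurable) encoder into a set of
`⌊2 ^ (T r)⌋` messages and a reconstructor that turns each message into a signal. -/
structure Code (T r : ℝ) where
  encode : PointPattern T → Fin ⌊(2 : ℝ) ^ (T * r)⌋₊
  measurable_encode : Measurable encode
  reconstruct : Fin ⌊(2 : ℝ) ^ (T * r)⌋₊ → Signal T

/-- `(R, D)` is an achievable rate-distortion pair for the random patterns `X T` on `[0, T]`. -/
def IsAchievable {Ω : ℝ → Type*} [∀ T, MeasurableSpace (Ω T)] (P : ∀ T, Measure (Ω T))
    (X : ∀ T, Ω T → PointPattern T) (R D : ℝ) : Prop :=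
  ∀ ε : ℝ, 0 < ε → ∃ T₀ : ℝ, 0 < T₀ ∧ ∀ T : ℝ, T₀ < T →
    ∃ c : Code T (R + ε),
      ∫⁻ ω, distortion (X T ω) (c.reconstruct (c.encode (X T ω))) ∂(P T) ≤ ENNReal.ofReal (D + ε)

/-- The function `-lam log D` (in bits) for `D < 1`, and `0` for `D ≥ 1`. -/
noncomputable def poissonRate (D lam : ℝ) : ℝ :=
  if D < 1 then -lam * Real.logb 2 D else 0

end PoissonCovering

/-! Write N for the number of points in (0, T]. Converse: a Poisson process satisfies E[1{X ⊆ B}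
c^N] ≤ exp(lam (c |B| - T)) for every set B of finite measure and every c > 0
(`lintegral_subset_le`). For a code with expected distortion at most d, let v_J be the measure of
the set selected by the message J, and put Y = N log(1/d) - lam (v_J / d - T). The inequality with c
= 1/d, summed over the messages, gives E[exp Y] ≤ 2^(T r), so E[Y] ≤ T r log 2 by Jensen. Since E[N]
= lam T and E[v_J] ≤ d T, also E[Y] ≥ lam T log(1/d). Hence r ≥ -lam log₂ d for every single T
(`log_le_of_lintegral_distortion_le`), and d = D + ε tends to D.

Achievability for D < 1: cut (0, T] into n equal cells and consider all unions of m cells, with m/n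
slightly above D. A pattern of at most K points lies in at least a fraction D^K of them, so a greedy
choice of M unions misses such patterns with probability at most (1 - D^K)^M
(`exists_covering_sets`). With K = ⌊a T⌋ and a slightly above lam, a Chernoff bound disposes of
patterns with more points, and the extra rate ε makes M D^K grow exponentially in T. For D ≥ 1 the
constant signal 1 suffices at rate 0, while a negative rate leaves no messages at all. -/

namespace PoissonCovering

open Filter Topology

/-! ### Counts of point patterns and their measurability. -/

namespace PointPattern

variable {T : ℝ}

lemma measurable_count {B : Set ℝ} (hB : MeasurableSet B) :
    Measurable (fun x : PointPattern T => x.count B) := by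
  rw [measurable_iff_comap_le]
  exact le_iSup₂_of_le (f := fun (B : Set ℝ) (_ : MeasurableSet B) =>
    MeasurableSpace.comap (fun x : PointPattern T => x.count B) ⊤) B hB le_rfl

lemma finite_inter (x : PointPattern T) (B : Set ℝ) : (x.points ∩ B).Finite :=
  x.finite.inter_of_left B

lemma count_eq_zero_iff (x : PointPattern T) (B : Set ℝ) :
    x.count B = 0 ↔ x.points ⊆ Bᶜ := by
  rw [count, Set.ncard_eq_zero (x.finite_inter B), ← Set.disjoint_iff_inter_eq_empty,
    Set.subset_compl_iff_disjoint_right]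

lemma measurableSet_subset {B : Set ℝ} (hB : MeasurableSet B) :
    MeasurableSet {x : PointPattern T | x.points ⊆ B} := by
  have : {x : PointPattern T | x.points ⊆ B} = (fun x => x.count Bᶜ) ⁻¹' {0} := by
    ext x; simp [count_eq_zero_iff]
  rw [this]
  exact measurable_count hB.compl (measurableSet_singleton 0)

lemma count_union (x : PointPattern T) {A B : Set ℝ} (h : Disjoint A B) :
    x.count (A ∪ B) = x.count A + x.count B := by
  rw [count, Set.inter_union_distrib_left, Set.ncard_union_eq _ (x.finite_inter A)
    (x.finite_inter B)]
  · rfl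
  · exact h.mono Set.inter_subset_right Set.inter_subset_right

lemma counting_eq_add (x : PointPattern T) {t u : ℝ} (ht : 0 ≤ t) (htu : t ≤ u) :
    x.counting u = x.counting t + x.count (Set.Ioc t u) := by
  rw [counting, counting, ← count_union, Set.Icc_union_Ioc_eq_Icc ht htu]
  rw [Set.disjoint_left]
  intro y hy hy'
  exact absurd hy.2 (not_le.2 hy'.1)

lemma zero_notMem_of_counting_zero {x : PointPattern T} (h : x.counting 0 = 0) :
    (0 : ℝ) ∉ x.points := by
  rw [counting, count_eq_zero_iff] at h
  intro h0
  exact h h0 (by simp)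

end PointPattern

/-! ### Generating function and mean of the Poisson law. -/

section PoissonLaw

lemma lintegral_pow_poissonMeasure (r : NNReal) {c : ℝ} (hc : 0 ≤ c) :
    ∫⁻ n, ENNReal.ofReal (c ^ n) ∂(poissonMeasure r) = ENNReal.ofReal (Real.exp (r * (c - 1))) := by
  have h : HasSum (fun n : ℕ => c ^ n * (Real.exp (-r) * r ^ n / n.factorial))
      (Real.exp (r * (c - 1))) := by
    have := (NormedSpace.expSeries_div_hasSum_exp ((r : ℝ) * c)).mul_left (Real.exp (-r))
    rw [← Real.exp_eq_exp_ℝ, ← Real.exp_add] at this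
    have e : (r : ℝ) * (c - 1) = -r + r * c := by ring
    rw [e]
    refine this.congr_fun fun n => ?_
    rw [mul_pow]; ring
  rw [lintegral_countable', ← h.tsum_eq, ENNReal.ofReal_tsum_of_nonneg _ h.summable]
  · congr with n
    rw [poissonMeasure_singleton, ← ENNReal.ofReal_mul (by positivity)]
  · intro n; positivity

lemma hasSum_mean_poissonMeasure (r : NNReal) :
    HasSum (fun n : ℕ => (Real.exp (-r) * r ^ n / n.factorial) * (n : ℝ)) r := by
  rw [← hasSum_nat_add_iff' 1]
  have := (hasSum_one_poissonMeasure r).mul_left (r : ℝ)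
  simp only [Finset.range_one, Finset.sum_singleton, Nat.cast_zero, mul_zero, sub_zero]
  rw [mul_one] at this
  refine this.congr_fun fun n => ?_
  rw [Nat.factorial_succ]
  push_cast
  field_simp
  ring

lemma integrable_natCast_poissonMeasure (r : NNReal) :
    Integrable (fun n : ℕ => (n : ℝ)) (poissonMeasure r) := by
  rw [integrable_poissonMeasure_iff]
  simpa using (hasSum_mean_poissonMeasure r).summable

lemma integral_natCast_poissonMeasure (r : NNReal) :
    ∫ n : ℕ, (n : ℝ) ∂(poissonMeasure r) = r := by
  rw [integral_poissonMeasure]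
  simpa using (hasSum_mean_poissonMeasure r).tsum_eq

end PoissonLaw

namespace IsPoissonProcess

variable {Ω : Type*} [MeasurableSpace Ω] {P : Measure Ω} {lam T : ℝ} {X : Ω → PointPattern T}

lemma measurable_count (hX : IsPoissonProcess P lam T X) {B : Set ℝ} (hB : MeasurableSet B) :
    Measurable (fun ω => (X ω).count B) :=
  (PointPattern.measurable_count hB).comp hX.measurable

lemma measurableSet_subset (hX : IsPoissonProcess P lam T X) {B : Set ℝ} (hB : MeasurableSet B) :
    MeasurableSet {ω | (X ω).points ⊆ B} :=
  hX.measurable (PointPattern.measurableSet_subset hB)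

lemma map_count_Ioc (hX : IsPoissonProcess P lam T X) (hlam : 0 < lam) {t u : ℝ}
    (ht : 0 ≤ t) (htu : t ≤ u) (hu : u ≤ T) :
    P.map (fun ω => (X ω).count (Set.Ioc t u)) = poissonMeasure (lam * (u - t)).toNNReal := by
  refine Measure.ext_of_singleton fun k => ?_
  rw [Measure.map_apply (hX.measurable_count measurableSet_Ioc) (measurableSet_singleton k),
    poissonMeasure_singleton,
    Real.coe_toNNReal _ (mul_nonneg hlam.le (sub_nonneg.2 htu)),
    ← hX.law_increments t (u - t) ht (by linarith) (by linarith) k]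
  congr 1
  ext ω
  simp [(X ω).counting_eq_add ht htu]

lemma iIndepFun_count_Ioc (hX : IsPoissonProcess P lam T X) {n : ℕ} {t : ℕ → ℝ}
    (ht : Monotone t) (h0 : ∀ i, 0 ≤ t i) (hT : ∀ i ≤ n, t i ≤ T) :
    iIndepFun (fun (i : Fin n) ω => ((X ω).count (Set.Ioc (t i) (t (i + 1))) : ℝ)) P := by
  have h := hX.indep_increments n
    (fun i => ⟨t i, h0 i, hT i (Nat.lt_succ_iff.1 i.2)⟩) (fun i j hij => ht (by exact_mod_cast hij))
  convert h using 2 with i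
  ext ω
  rw [eq_sub_iff_add_eq, add_comm]
  have := ((X ω).counting_eq_add (h0 i) (ht (Nat.le_succ i))).symm
  simp only [Fin.val_succ, Fin.val_castSucc]
  exact_mod_cast this

end IsPoissonProcess

/-! ### The grid of cells. -/

/-- The `i`-th of the `n` half-open intervals of length `T / n` into which `(0, T]` is divided. -/
def cell (T : ℝ) (n i : ℕ) : Set ℝ := Set.Ioc (i * (T / n)) ((i + 1 : ℕ) * (T / n))

/-- The union of the cells whose index lies in `S`. -/
def cells (T : ℝ) (n : ℕ) (S : Finset (Fin n)) : Set ℝ := ⋃ i ∈ S, cell T n i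

section Cells

variable {T : ℝ} {n : ℕ}

lemma monotone_grid (hT : 0 < T) (n : ℕ) : Monotone fun i : ℕ => (i : ℝ) * (T / n) :=
  fun i j hij => mul_le_mul_of_nonneg_right (by exact_mod_cast hij) (by positivity)

lemma measurableSet_cell (i : ℕ) : MeasurableSet (cell T n i) := measurableSet_Ioc

lemma measurableSet_cells (S : Finset (Fin n)) : MeasurableSet (cells T n S) :=
  S.measurableSet_biUnion fun i _ => measurableSet_cell i

lemma pairwise_disjoint_cell (hT : 0 < T) : Pairwise (Function.onFun Disjoint (cell T n)) :=
  (monotone_grid hT n).pairwise_disjoint_on_Ioc_succ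

lemma grid_self (hn : n ≠ 0) : (n : ℝ) * (T / n) = T := by
  field_simp

lemma volume_cell (i : ℕ) : volume (cell T n i) = ENNReal.ofReal (T / n) := by
  rw [cell, Real.volume_Ioc]
  congr 1
  push_cast
  ring

lemma volume_cells (hT : 0 < T) (S : Finset (Fin n)) :
    volume (cells T n S) = ENNReal.ofReal (S.card * (T / n)) := by
  rw [cells, measure_biUnion_finset (f := fun i : Fin n => cell T n i) ?_
    fun i _ => measurableSet_cell i]
  · simp_rw [volume_cell]
    rw [Finset.sum_const, nsmul_eq_mul, ENNReal.ofReal_mul (by positivity), ENNReal.ofReal_natCast]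
  · intro i _ j _ hij
    exact pairwise_disjoint_cell hT (fun h => hij (Fin.ext h))

lemma exists_mem_cell (hT : 0 < T) (hn : n ≠ 0) {p : ℝ} (hp : p ∈ Set.Ioc 0 T) :
    ∃ i : Fin n, p ∈ cell T n i := by
  have hh : 0 < T / n := by positivity
  have hpos : 0 < ⌈p / (T / n)⌉₊ := Nat.ceil_pos.2 (div_pos hp.1 hh)
  have hle : ⌈p / (T / n)⌉₊ ≤ n := by
    rw [Nat.ceil_le, div_le_iff₀ hh, grid_self hn]
    exact hp.2
  refine ⟨⟨⌈p / (T / n)⌉₊ - 1, by omega⟩, ?_, ?_⟩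
  · have h1 := Nat.ceil_lt_add_one (div_pos hp.1 hh).le
    rw [← lt_div_iff₀ hh]
    simp only
    rw [Nat.cast_sub hpos, Nat.cast_one]
    linarith
  · simp only
    rw [Nat.sub_add_cancel hpos, ← div_le_iff₀ hh]
    exact Nat.le_ceil _

lemma PointPattern.count_Ioc_eq_sum (hT : 0 < T) (hn : n ≠ 0) (x : PointPattern T) :
    x.count (Set.Ioc 0 T) = ∑ i : Fin n, x.count (cell T n i) := by
  have key : ∀ k : ℕ, x.count (Set.Ioc 0 ((k : ℝ) * (T / n))) =
      ∑ i ∈ Finset.range k, x.count (cell T n i) := by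
    intro k
    induction k with
    | zero => simp [PointPattern.count]
    | succ k ih =>
      rw [Finset.sum_range_succ, ← ih, ← count_union, cell,
        Set.Ioc_union_Ioc_eq_Ioc (by positivity) (monotone_grid hT n (Nat.le_succ k))]
      exact Set.Ioc_disjoint_Ioc_of_le le_rfl
  rw [Fin.sum_univ_eq_sum_range (fun i => x.count (cell T n i)), ← key, grid_self hn]

lemma PointPattern.count_cell_eq_zero (hT : 0 < T) {x : PointPattern T}
    {S : Finset (Fin n)} (hx : x.points ⊆ insert 0 (cells T n S)) {i : Fin n} (hi : i ∉ S) :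
    x.count (cell T n i) = 0 := by
  rw [count_eq_zero_iff]
  intro p hp hpi
  rcases hx hp with rfl | h
  · have : (0 : ℝ) ≤ i * (T / n) := by positivity
    exact absurd hpi.1 (not_lt.2 this)
  · obtain ⟨j, hj, hpj⟩ := Set.mem_iUnion₂.1 h
    have hij : (i : ℕ) ≠ j := fun h => hi (by rwa [Fin.ext h])
    exact Set.disjoint_left.1 (pairwise_disjoint_cell hT hij) hpi hpj

/-- On a fine enough grid, the cell around each of the finitely many points fits in a ball inside
`U`. The point 0 is adjoined because the cells only partition (0, T]. -/
lemma PointPattern.exists_subset_cells (hT : 0 < T) {U : Set ℝ} (hU : IsOpen U)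
    (x : PointPattern T) (hx : x.points ⊆ U) :
    ∀ᶠ n : ℕ in atTop, ∃ S : Finset (Fin n), cells T n S ⊆ U ∧
      x.points ⊆ insert 0 (cells T n S) := by
  classical
  have h : ∀ p ∈ x.points, ∀ᶠ n : ℕ in atTop, ∀ i : Fin n, p ∈ cell T n i → cell T n i ⊆ U := by
    intro p hp
    obtain ⟨ε, hε, hball⟩ := Metric.isOpen_iff.1 hU p (hx hp)
    have hlim : Tendsto (fun n : ℕ => T / n) atTop (𝓝 0) := tendsto_const_div_atTop_nhds_zero_nat T
    filter_upwards [hlim.eventually (gt_mem_nhds hε)] with n hn i hpi q hq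
    apply hball
    rw [Metric.mem_ball, Real.dist_eq, abs_lt]
    rcases hpi with ⟨h1, h2⟩
    rcases hq with ⟨h3, h4⟩
    push_cast at h2 h4
    constructor <;> linarith
  filter_upwards [(x.finite.eventually_all).2 h, eventually_ne_atTop 0] with n hn hn0
  refine ⟨Finset.univ.filter fun i => cell T n i ⊆ U, ?_, ?_⟩
  · refine Set.iUnion₂_subset fun i hi => ?_
    simpa using hi
  · intro p hp
    rcases (x.subset hp).1.eq_or_lt with h0 | h0
    · exact Or.inl h0.symm
    · obtain ⟨i, hi⟩ := exists_mem_cell hT hn0 ⟨h0, (x.subset hp).2⟩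
      refine Or.inr (Set.mem_iUnion₂.2 ⟨i, ?_, hi⟩)
      simpa using hn p hp i hi

end Cells

/-! ### The exponential covering inequality. -/

namespace IsPoissonProcess

variable {Ω : Type*} [MeasurableSpace Ω] {P : Measure Ω} {lam T : ℝ} {X : Ω → PointPattern T}

lemma lintegral_pow_count_Ioc (hX : IsPoissonProcess P lam T X) (hlam : 0 < lam) {t u : ℝ}
    (ht : 0 ≤ t) (htu : t ≤ u) (hu : u ≤ T) {c : ℝ} (hc : 0 ≤ c) :
    ∫⁻ ω, ENNReal.ofReal (c ^ (X ω).count (Set.Ioc t u)) ∂P =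
      ENNReal.ofReal (Real.exp (lam * (u - t) * (c - 1))) := by
  have hr : 0 ≤ lam * (u - t) := mul_nonneg hlam.le (sub_nonneg.2 htu)
  rw [← lintegral_map (f := fun n : ℕ => ENNReal.ofReal (c ^ n)) .of_discrete
      (hX.measurable_count measurableSet_Ioc),
    hX.map_count_Ioc hlam ht htu hu, lintegral_pow_poissonMeasure _ hc, Real.coe_toNNReal _ hr]

lemma integrable_count (hX : IsPoissonProcess P lam T X) (hlam : 0 < lam) (hT : 0 < T) :
    Integrable (fun ω => ((X ω).count (Set.Ioc 0 T) : ℝ)) P := by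
  have h := integrable_natCast_poissonMeasure (lam * (T - 0)).toNNReal
  rw [← hX.map_count_Ioc hlam le_rfl hT.le le_rfl] at h
  exact h.comp_measurable (hX.measurable_count measurableSet_Ioc)

lemma integral_count (hX : IsPoissonProcess P lam T X) (hlam : 0 < lam) (hT : 0 < T) :
    ∫ ω, ((X ω).count (Set.Ioc 0 T) : ℝ) ∂P = lam * T := by
  have hr : 0 ≤ lam * (T - 0) := by rw [sub_zero]; positivity
  have h := integral_natCast_poissonMeasure (lam * (T - 0)).toNNReal
  rw [← hX.map_count_Ioc hlam le_rfl hT.le le_rfl,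
    integral_map (hX.measurable_count measurableSet_Ioc).aemeasurable
      (Measurable.of_discrete.aestronglyMeasurable)] at h
  rw [h, Real.coe_toNNReal _ hr, sub_zero]

lemma measure_count_Ioc_eq_zero (hX : IsPoissonProcess P lam T X) {t u : ℝ}
    (ht : 0 ≤ t) (htu : t ≤ u) (hu : u ≤ T) :
    P {ω | (X ω).count (Set.Ioc t u) = 0} = ENNReal.ofReal (Real.exp (-(lam * (u - t)))) := by
  have h := hX.law_increments t (u - t) ht (by linarith) (by linarith) 0
  simp only [pow_zero, Nat.factorial_zero, Nat.cast_one, mul_one, div_one] at h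
  rw [← h]
  congr 1
  ext ω
  simp [(X ω).counting_eq_add ht htu]

/-- Cells are independent: one in `S` contributes exp(lam (T/n) (c - 1)), one outside must be empty
and contributes exp(-lam T/n). The bound is the product of these factors. -/
lemma lintegral_cells_le (hX : IsPoissonProcess P lam T X) (hlam : 0 < lam) (hT : 0 < T)
    {n : ℕ} (hn : n ≠ 0) (S : Finset (Fin n)) {c : ℝ} (hc : 0 < c) :
    ∫⁻ ω, {ω | (X ω).points ⊆ insert 0 (cells T n S)}.indicator
        (fun ω => ENNReal.ofReal (c ^ (X ω).count (Set.Ioc 0 T))) ω ∂P ≤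
      ENNReal.ofReal (Real.exp (lam * (c * (S.card * (T / n)) - T))) := by
  classical
  -- The factors take real arguments because independence of increments is stated for real-valued
  -- counts.
  let F : Fin n → ℝ → ℝ≥0∞ := fun i k =>
    if i ∈ S then ENNReal.ofReal (c ^ k) else Set.indicator {0} 1 k
  have hF : ∀ i, Measurable (F i) := by
    intro i
    by_cases hi : i ∈ S
    · simp only [F, hi, if_true]
      fun_prop
    · simp only [F, hi, if_false]
      exact measurable_one.indicator (measurableSet_singleton 0)
  have hcell : ∀ i : Fin n, Measurable fun ω => ((X ω).count (cell T n i) : ℝ) := fun i =>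
    measurable_from_nat.comp (hX.measurable_count (measurableSet_cell i))
  have hend : ∀ i ≤ n, (i : ℝ) * (T / n) ≤ T := fun i hi => by
    have := monotone_grid hT n hi
    simp only at this
    rwa [grid_self hn] at this
  have hind := (hX.iIndepFun_count_Ioc (monotone_grid hT n) (fun i => by positivity) hend).comp F hF
  have hlen : ∀ i : ℕ, ((i + 1 : ℕ) : ℝ) * (T / n) - i * (T / n) = T / n := fun i => by
    push_cast; ring
  have hint : ∀ i : Fin n, ∫⁻ ω, F i ((X ω).count (cell T n i) : ℝ) ∂P =
      ENNReal.ofReal (Real.exp (if i ∈ S then lam * (T / n) * (c - 1) else -(lam * (T / n)))) := by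
    intro i
    have h1 : 0 ≤ (i : ℝ) * (T / n) := by positivity
    have h2 := monotone_grid hT n (Nat.le_succ i)
    have h3 := hend (i + 1) i.2
    by_cases hi : i ∈ S
    · simp only [F, hi, if_true, Real.rpow_natCast]
      rw [cell, hX.lintegral_pow_count_Ioc hlam h1 h2 h3 hc.le, hlen]
    · simp only [F, hi, if_false]
      have hm : MeasurableSet {ω | (X ω).count (cell T n i) = 0} :=
        hX.measurable_count (measurableSet_cell i) (measurableSet_singleton 0)
      rw [← hlen i, ← hX.measure_count_Ioc_eq_zero h1 h2 h3]
      refine Eq.trans ?_ (lintegral_indicator_one hm)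
      congr with ω
      simp [Set.indicator_apply, cell]
  calc _ ≤ ∫⁻ ω, ∏ i : Fin n, F i ((X ω).count (cell T n i) : ℝ) ∂P := by
        refine lintegral_mono fun ω => Set.indicator_apply_le' (fun hω => ?_) (fun _ => zero_le)
        rw [PointPattern.count_Ioc_eq_sum hT hn, ← Finset.prod_pow_eq_pow_sum,
          ENNReal.ofReal_prod_of_nonneg fun i _ => by positivity]
        refine Finset.prod_le_prod' fun i _ => ?_
        by_cases hi : i ∈ S
        · simp [F, hi]
        · simp [F, hi, PointPattern.count_cell_eq_zero hT hω hi]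
    _ = ∏ i : Fin n, ∫⁻ ω, F i ((X ω).count (cell T n i) : ℝ) ∂P :=
        lintegral_prod_eq_prod_lintegral_of_indepFun _ _ hind fun i => (hF i).comp (hcell i)
    _ ≤ _ := by
        simp_rw [hint]
        rw [← ENNReal.ofReal_prod_of_nonneg fun i _ => by positivity, ← Real.exp_sum]
        refine ENNReal.ofReal_le_ofReal (Real.exp_le_exp.2 (le_of_eq ?_))
        have h1 : ∀ i : Fin n, (if i ∈ S then lam * (T / n) * (c - 1) else -(lam * (T / n))) =
            (if i ∈ S then lam * (T / n) * c else 0) - lam * (T / n) := by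
          intro i; split_ifs <;> ring
        simp_rw [h1]
        rw [Finset.sum_sub_distrib, Finset.sum_ite_mem, Finset.univ_inter, Finset.sum_const,
          Finset.sum_const, Finset.card_univ, Fintype.card_fin, nsmul_eq_mul, nsmul_eq_mul]
        field_simp

/-- Fatou's lemma along the grids: a pattern inside `U` is eventually inside the union of the cells
contained in `U`. -/
lemma lintegral_open_le (hX : IsPoissonProcess P lam T X) (hlam : 0 < lam) (hT : 0 < T)
    {U : Set ℝ} (hU : IsOpen U) (hU' : volume U ≠ ∞) {c : ℝ} (hc : 0 < c) :
    ∫⁻ ω, {ω | (X ω).points ⊆ U}.indicator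
        (fun ω => ENNReal.ofReal (c ^ (X ω).count (Set.Ioc 0 T))) ω ∂P ≤
      ENNReal.ofReal (Real.exp (lam * (c * (volume U).toReal - T))) := by
  classical
  let S : ∀ n : ℕ, Finset (Fin n) := fun n => Finset.univ.filter fun i => cell T n i ⊆ U
  have hS : ∀ n, cells T n (S n) ⊆ U := fun n =>
    Set.iUnion₂_subset fun i hi => by simpa [S] using hi
  have hmeas : ∀ B : Set ℝ, MeasurableSet B → Measurable ({ω | (X ω).points ⊆ B}.indicator
      (fun ω => ENNReal.ofReal (c ^ (X ω).count (Set.Ioc 0 T)))) := fun B hB =>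
    (ENNReal.measurable_ofReal.comp (measurable_from_nat.comp
      (hX.measurable_count measurableSet_Ioc))).indicator (hX.measurableSet_subset hB)
  calc _ ≤ ∫⁻ ω, liminf (fun n => {ω | (X ω).points ⊆ insert 0 (cells T n (S n))}.indicator
          (fun ω => ENNReal.ofReal (c ^ (X ω).count (Set.Ioc 0 T))) ω) atTop ∂P := by
        refine lintegral_mono fun ω => Set.indicator_apply_le' (fun hω => ?_) (fun _ => zero_le)
        refine le_liminf_of_le (by isBoundedDefault) ?_
        filter_upwards [(X ω).exists_subset_cells hT hU hω] with n ⟨S', h1, h2⟩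
        have hsub : cells T n S' ⊆ cells T n (S n) := by
          refine Set.biUnion_subset_biUnion_left fun i hi => ?_
          simpa [S] using (Set.subset_biUnion_of_mem (u := fun i : Fin n => cell T n i)
            (show i ∈ (S' : Set (Fin n)) from hi)).trans h1
        rw [Set.indicator_of_mem]
        exact h2.trans (Set.insert_subset_insert hsub)
    _ ≤ liminf (fun n => ∫⁻ ω, {ω | (X ω).points ⊆ insert 0 (cells T n (S n))}.indicator
          (fun ω => ENNReal.ofReal (c ^ (X ω).count (Set.Ioc 0 T))) ω ∂P) atTop :=
        lintegral_liminf_le fun n => hmeas _ ((measurableSet_cells _).insert 0)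
    _ ≤ _ := by
        refine liminf_le_of_frequently_le' (Eventually.frequently ?_)
        filter_upwards [eventually_ne_atTop 0] with n hn
        refine (hX.lintegral_cells_le hlam hT hn (S n) hc).trans
          (ENNReal.ofReal_le_ofReal (Real.exp_le_exp.2 ?_))
        have hv : (S n).card * (T / n) ≤ (volume U).toReal := by
          rw [← ENNReal.ofReal_le_iff_le_toReal hU', ← volume_cells hT]
          exact measure_mono (hS n)
        gcongr

/-- Outer regularity passes from open sets to arbitrary ones; `B` need not be measurable. -/
lemma lintegral_subset_le (hX : IsPoissonProcess P lam T X) (hlam : 0 < lam) (hT : 0 < T)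
    {B : Set ℝ} (hB : volume B ≠ ∞) {c : ℝ} (hc : 0 < c) :
    ∫⁻ ω, {ω | (X ω).points ⊆ B}.indicator
        (fun ω => ENNReal.ofReal (c ^ (X ω).count (Set.Ioc 0 T))) ω ∂P ≤
      ENNReal.ofReal (Real.exp (lam * (c * (volume B).toReal - T))) := by
  have hlim : Tendsto (fun δ : ℝ => ENNReal.ofReal
      (Real.exp (lam * (c * ((volume B).toReal + δ) - T)))) (𝓝[>] 0)
      (𝓝 (ENNReal.ofReal (Real.exp (lam * (c * (volume B).toReal - T))))) := by
    refine (Continuous.tendsto' ?_ 0 _ (by simp)).mono_left nhdsWithin_le_nhds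
    exact ENNReal.continuous_ofReal.comp (by fun_prop)
  refine ge_of_tendsto hlim ?_
  filter_upwards [self_mem_nhdsWithin] with δ hδ
  have hδ' : (0 : ℝ) < δ := hδ
  obtain ⟨U, hBU, hU, hvU⟩ := B.exists_isOpen_lt_add hB
    (ENNReal.ofReal_pos.2 hδ').ne'
  refine (lintegral_mono fun ω => Set.indicator_le_indicator_of_subset
    (fun ω hω => Set.Subset.trans hω hBU) (fun _ => zero_le) ω).trans
    ((hX.lintegral_open_le hlam hT hU (hvU.trans_le le_top).ne hc).trans
      (ENNReal.ofReal_le_ofReal (Real.exp_le_exp.2 ?_)))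
  have : (volume U).toReal ≤ (volume B).toReal + δ := by
    rw [← ENNReal.toReal_ofReal hδ'.le, ← ENNReal.toReal_add hB ENNReal.ofReal_ne_top]
    exact ENNReal.toReal_mono (by finiteness) hvU.le
  gcongr

end IsPoissonProcess

lemma Signal.selected_subset {T : ℝ} (s : Signal T) : s.selected ⊆ Set.Icc 0 T := by
  rintro _ ⟨t, _, rfl⟩
  exact t.2

/-! ### Converse: lower bound on the rate. -/

section Converse

variable {Ω : Type*} [MeasurableSpace Ω] {P : Measure Ω} [IsProbabilityMeasure P]
  {lam T r : ℝ} {X : Ω → PointPattern T}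

lemma IsPoissonProcess.log_le_of_lintegral_distortion_le (hX : IsPoissonProcess P lam T X)
    (hlam : 0 < lam) (hT : 0 < T) (C : Code T r) {d : ℝ} (hd : 0 < d)
    (h : ∫⁻ ω, distortion (X ω) (C.reconstruct (C.encode (X ω))) ∂P ≤ ENNReal.ofReal d) :
    -(lam * Real.log d) ≤ r * Real.log 2 := by
  classical
  -- Selected sets are only Lebesgue measurable, whereas covering events are measurable for Borel
  -- sets. The measurable hull keeps the volume and can only lower the distortion.
  let B : Fin ⌊(2 : ℝ) ^ (T * r)⌋₊ → Set ℝ := fun m => toMeasurable volume (C.reconstruct m).selected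
  let v : Fin ⌊(2 : ℝ) ^ (T * r)⌋₊ → ℝ := fun m => (volume (B m)).toReal
  let J : Ω → Fin ⌊(2 : ℝ) ^ (T * r)⌋₊ := fun ω => C.encode (X ω)
  let N : Ω → ℕ := fun ω => (X ω).count (Set.Ioc 0 T)
  have hB : ∀ m, MeasurableSet (B m) := fun m => measurableSet_toMeasurable _ _
  have hvol : ∀ m, volume (B m) ≤ ENNReal.ofReal T := fun m => by
    rw [measure_toMeasurable]
    simpa using measure_mono (μ := volume) (C.reconstruct m).selected_subset
  have hfin : ∀ m, volume (B m) ≠ ∞ := fun m => ((hvol m).trans_lt ENNReal.ofReal_lt_top).ne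
  have hvT : ∀ m, v m ≤ T := fun m => ENNReal.toReal_le_of_le_ofReal hT.le (hvol m)
  have hv0 : ∀ m, 0 ≤ v m := fun m => ENNReal.toReal_nonneg
  have hJ : Measurable J := C.measurable_encode.comp hX.measurable
  have hN : Measurable N := hX.measurable_count measurableSet_Ioc
  have hvJ : Measurable fun ω => v (J ω) := (Measurable.of_discrete (f := v)).comp hJ
  have hdist : ∀ ω, (if (X ω).points ⊆ B (J ω) then ENNReal.ofReal (v (J ω) / T) else ∞) ≤
      distortion (X ω) (C.reconstruct (C.encode (X ω))) := by
    intro ω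
    rw [distortion]
    by_cases hs : (X ω).points ⊆ (C.reconstruct (C.encode (X ω))).selected
    · rw [if_pos hs, if_pos (hs.trans (subset_toMeasurable _ _)), ENNReal.ofReal_div_of_pos hT,
        ENNReal.ofReal_toReal (hfin _), measure_toMeasurable]
    · rw [if_neg hs]
      exact le_top
  have hcov : MeasurableSet {ω | (X ω).points ⊆ B (J ω)} := by
    have : {ω | (X ω).points ⊆ B (J ω)} = ⋃ m, J ⁻¹' {m} ∩ {ω | (X ω).points ⊆ B m} := by
      ext ω; simp
    rw [this]
    exact MeasurableSet.iUnion fun m =>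
      (hJ (measurableSet_singleton m)).inter (hX.measurableSet_subset (hB m))
  -- A finite expectation forces the patterns to be covered almost surely.
  have hint := (lintegral_mono hdist).trans h
  have hae : ∀ᵐ ω ∂P, (X ω).points ⊆ B (J ω) := by
    have hm : Measurable fun ω =>
        if (X ω).points ⊆ B (J ω) then ENNReal.ofReal (v (J ω) / T) else ∞ :=
      Measurable.ite hcov (ENNReal.measurable_ofReal.comp (hvJ.div_const T)) measurable_const
    filter_upwards [ae_lt_top hm (hint.trans_lt ENNReal.ofReal_lt_top).ne] with ω hω
    by_contra hn
    simp [hn] at hω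
  have hvi : Integrable (fun ω => v (J ω)) P :=
    Integrable.of_bound hvJ.aestronglyMeasurable T
      (Eventually.of_forall fun ω => by rw [Real.norm_of_nonneg (hv0 _)]; exact hvT _)
  have hmean : ∫ ω, v (J ω) ∂P ≤ d * T := by
    rw [← div_le_iff₀ hT, ← integral_div, ← ENNReal.ofReal_le_ofReal_iff hd.le,
      ofReal_integral_eq_lintegral_ofReal (hvi.div_const T)
        (Eventually.of_forall fun ω => div_nonneg (hv0 _) hT.le)]
    refine (lintegral_mono fun ω => ?_).trans hint
    split_ifs
    · exact le_rfl
    · exact le_top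
  let Y : Ω → ℝ := fun ω => (N ω : ℝ) * Real.log d⁻¹ - lam * (d⁻¹ * v (J ω) - T)
  have hNi : Integrable (fun ω => (N ω : ℝ)) P := hX.integrable_count hlam hT
  have hvc : Integrable (fun ω => lam * (d⁻¹ * v (J ω) - T)) P :=
    ((hvi.const_mul _).sub (integrable_const T)).const_mul lam
  have hYi : Integrable Y P := (hNi.mul_const _).sub hvc
  have hY : lam * T * Real.log d⁻¹ ≤ ∫ ω, Y ω ∂P := by
    have e : ∫ ω, Y ω ∂P = lam * T * Real.log d⁻¹ - lam * (d⁻¹ * ∫ ω, v (J ω) ∂P - T) := by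
      rw [integral_sub (hNi.mul_const _) hvc, integral_mul_const, integral_const_mul,
        integral_sub (hvi.const_mul _) (integrable_const T), integral_const_mul,
        hX.integral_count hlam hT]
      simp
    have : d⁻¹ * ∫ ω, v (J ω) ∂P ≤ T := by
      rwa [inv_mul_le_iff₀ hd]
    rw [e]
    nlinarith
  have hbound : ∫⁻ ω, ENNReal.ofReal (Real.exp (Y ω)) ∂P ≤ (⌊(2 : ℝ) ^ (T * r)⌋₊ : ℝ≥0∞) := by
    let g : Fin ⌊(2 : ℝ) ^ (T * r)⌋₊ → Ω → ℝ≥0∞ := fun m ω =>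
      {ω | (X ω).points ⊆ B m}.indicator (fun ω => ENNReal.ofReal (d⁻¹ ^ N ω)) ω
    have hg : ∀ m, Measurable (g m) := fun m =>
      (ENNReal.measurable_ofReal.comp (measurable_from_nat.comp hN)).indicator
        (hX.measurableSet_subset (hB m))
    -- Almost surely exp Y is the summand with m = J, so the sum over all messages dominates it,
    -- whatever the encoder. Each summand has integral at most 1.
    calc _ ≤ ∫⁻ ω, ∑ m, g m ω * ENNReal.ofReal (Real.exp (-(lam * (d⁻¹ * v m - T)))) ∂P := by
          refine lintegral_mono_ae ?_
          filter_upwards [hae] with ω hω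
          refine le_trans (le_of_eq ?_) (Finset.single_le_sum (fun _ _ => zero_le)
            (Finset.mem_univ (J ω)))
          simp only [g]
          rw [Set.indicator_of_mem (by exact hω), ← ENNReal.ofReal_mul (by positivity)]
          congr 1
          simp only [Y]
          rw [sub_eq_add_neg, Real.exp_add, Real.exp_nat_mul, Real.exp_log (by positivity)]
      _ = ∑ m, (∫⁻ ω, g m ω ∂P) * ENNReal.ofReal (Real.exp (-(lam * (d⁻¹ * v m - T)))) := by
          rw [lintegral_finsetSum _ fun m _ => (hg m).mul_const _]
          simp_rw [lintegral_mul_const _ (hg _)]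
      _ ≤ ∑ m : Fin ⌊(2 : ℝ) ^ (T * r)⌋₊, 1 := by
          refine Finset.sum_le_sum fun m _ => ?_
          refine (mul_le_mul_left (hX.lintegral_subset_le hlam hT (hfin m) (inv_pos.2 hd)) _).trans
            (le_of_eq ?_)
          rw [← ENNReal.ofReal_mul (by positivity), ← Real.exp_add]
          simp [v]
      _ = _ := by simp
  have hexpi : Integrable (fun ω => Real.exp (Y ω)) P := by
    refine ⟨Real.continuous_exp.comp_aestronglyMeasurable hYi.aestronglyMeasurable, ?_⟩
    rw [hasFiniteIntegral_iff_ofReal (Eventually.of_forall fun ω => (Real.exp_pos _).le)]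
    exact hbound.trans_lt (ENNReal.natCast_lt_top _)
  have hjensen : Real.exp (∫ ω, Y ω ∂P) ≤ ∫ ω, Real.exp (Y ω) ∂P :=
    convexOn_exp.map_integral_le Real.continuous_exp.continuousOn isClosed_univ
      (Eventually.of_forall fun _ => Set.mem_univ _) hYi hexpi
  have hle : ∫ ω, Real.exp (Y ω) ∂P ≤ (2 : ℝ) ^ (T * r) := by
    refine le_trans ?_ (Nat.floor_le (by positivity))
    rw [← ENNReal.ofReal_le_ofReal_iff (Nat.cast_nonneg _), ENNReal.ofReal_natCast,
      ofReal_integral_eq_lintegral_ofReal hexpi (Eventually.of_forall fun ω => (Real.exp_pos _).le)]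
    exact hbound
  have hfinal : lam * T * Real.log d⁻¹ ≤ T * r * Real.log 2 := by
    rw [mul_comm (T * r), ← Real.exp_le_exp, ← Real.rpow_def_of_pos two_pos]
    exact (Real.exp_le_exp.2 hY).trans (hjensen.trans hle)
  rw [Real.log_inv] at hfinal
  refine le_of_mul_le_mul_left ?_ hT
  linarith

end Converse

theorem poissonRate_le_of_isAchievable {Ω : ℝ → Type*} [∀ T, MeasurableSpace (Ω T)]
    {P : ∀ T, Measure (Ω T)} [∀ T, IsProbabilityMeasure (P T)] {X : ∀ T, Ω T → PointPattern T}
    {R D lam : ℝ} (hD : 0 < D) (hlam : 0 < lam)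
    (hX : ∀ T, 0 < T → IsPoissonProcess (P T) lam T (X T)) (h : IsAchievable P X R D) :
    poissonRate D lam ≤ R := by
  rw [poissonRate]
  split_ifs with hD1
  · have hlim₁ : Tendsto (fun ε : ℝ => -(lam * Real.log (D + ε))) (𝓝[>] 0)
        (𝓝 (-(lam * Real.log D))) := by
      have h1 : ContinuousAt (fun ε : ℝ => -(lam * Real.log (D + ε))) 0 :=
        (((continuousAt_const.add continuousAt_id).log (by simpa using hD.ne')).const_mul lam).neg
      have h2 := h1.tendsto.mono_left (nhdsWithin_le_nhds (s := Set.Ioi 0))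
      simpa using h2
    have hlim₂ : Tendsto (fun ε : ℝ => (R + ε) * Real.log 2) (𝓝[>] 0) (𝓝 (R * Real.log 2)) :=
      (Continuous.tendsto' (by fun_prop) _ _ (by simp)).mono_left nhdsWithin_le_nhds
    have hle : -(lam * Real.log D) ≤ R * Real.log 2 := by
      refine le_of_tendsto_of_tendsto hlim₁ hlim₂ ?_
      filter_upwards [self_mem_nhdsWithin] with ε hε
      have hε' : (0 : ℝ) < ε := hε
      obtain ⟨T₀, hT₀, hc⟩ := h ε hε
      -- The bound on the rate holds at each fixed T, so one admissible T is enough.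
      obtain ⟨C, hC⟩ := hc (T₀ + 1) (by linarith)
      exact (hX _ (by linarith)).log_le_of_lintegral_distortion_le hlam (by linarith) C
        (by linarith) hC
    rw [Real.logb, neg_mul, ← mul_div_assoc, ← neg_div, div_le_iff₀ (Real.log_pos one_lt_two)]
    exact hle
  · by_contra! hR
    -- This choice leaves the negative rate R / 2, so the message set is empty and no encoder
    -- exists.
    obtain ⟨T₀, hT₀, hc⟩ := h (-R / 2) (by linarith)
    obtain ⟨C, -⟩ := hc (T₀ + 1) (by linarith)
    obtain ⟨ω⟩ := nonempty_of_isProbabilityMeasure (P (T₀ + 1))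
    have h0 : ⌊(2 : ℝ) ^ ((T₀ + 1) * (R + -R / 2))⌋₊ = 0 := by
      rw [Nat.floor_eq_zero]
      exact Real.rpow_lt_one_of_one_lt_of_neg one_lt_two (by nlinarith)
    exact Fin.elim0 (h0 ▸ C.encode (X _ ω))

/-! ### Codes built from lists of sets. -/

lemma indicator_preimage_one {T : ℝ} (B : Set ℝ) :
    (Subtype.val ⁻¹' B).indicator (1 : Set.Icc (0 : ℝ) T → Fin 2) ⁻¹' {1} = Subtype.val ⁻¹' B := by
  classical
  ext t
  rw [Set.mem_preimage, Set.mem_singleton_iff, Set.indicator_apply]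
  split_ifs with h <;> simp only [h, Pi.one_apply, zero_ne_one]

/-- The signal that is equal to `1` exactly on the Borel set `B`. -/
noncomputable def Signal.ofSet (T : ℝ) (B : Set ℝ) (hB : MeasurableSet B) : Signal T where
  val := (Subtype.val ⁻¹' B).indicator 1
  measurable := by
    rw [indicator_preimage_one, Subtype.image_preimage_coe]
    exact (measurableSet_Icc.inter hB).nullMeasurableSet

lemma Signal.selected_ofSet {T : ℝ} {B : Set ℝ} (hB : MeasurableSet B) :
    (Signal.ofSet T B hB).selected = Set.Icc 0 T ∩ B := by
  rw [Signal.selected, Signal.ofSet, indicator_preimage_one, Subtype.image_preimage_coe]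

lemma distortion_ofSet_univ_le {T : ℝ} (x : PointPattern T) :
    distortion x (Signal.ofSet T Set.univ MeasurableSet.univ) ≤ 1 := by
  rw [distortion, Signal.selected_ofSet, Set.inter_univ, if_pos x.subset, Real.volume_Icc, sub_zero]
  exact ENNReal.div_self_le_one

lemma distortion_ofSet_le {T a : ℝ} (hT : 0 < T) {x : PointPattern T} {B : Set ℝ}
    (hB : MeasurableSet B) (hx : x.points ⊆ B) (hvol : volume B ≤ ENNReal.ofReal (a * T)) :
    distortion x (Signal.ofSet T B hB) ≤ ENNReal.ofReal a := by
  rw [distortion, Signal.selected_ofSet, if_pos (Set.subset_inter x.subset hx)]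
  refine ENNReal.div_le_of_le_mul ?_
  rw [← ENNReal.ofReal_mul' hT.le]
  exact (measure_mono Set.inter_subset_right).trans hvol

/-- A list of Borel sets of small measure gives a code with one message for each set and one
message more for the patterns that none of the sets covers. -/
lemma exists_encoder {T a : ℝ} (hT : 0 < T) {M n : ℕ} (hn : n = M + 1) (s : Fin M → Set ℝ)
    (hs : ∀ j, MeasurableSet (s j)) (hvol : ∀ j, volume (s j) ≤ ENNReal.ofReal (a * T)) :
    ∃ (e : PointPattern T → Fin n) (φ : Fin n → Signal T), Measurable e ∧
      ∀ x, distortion x (φ (e x)) ≤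
        ENNReal.ofReal a + {x : PointPattern T | ∀ j, ¬ x.points ⊆ s j}.indicator 1 x := by
  classical
  subst hn
  -- The encoder sends the least index of a covering set. The default index `M` is decoded as the
  -- constant signal 1, whose distortion is at most 1.
  let p : PointPattern T → ℕ → Prop := fun x k => (∃ h : k < M, x.points ⊆ s ⟨k, h⟩) ∨ k = M
  have hp : ∀ x, ∃ k, p x k := fun x => ⟨M, Or.inr rfl⟩
  have hle : ∀ x, Nat.find (hp x) < M + 1 := fun x =>
    Nat.lt_succ_of_le (Nat.find_min' (hp x) (Or.inr rfl))
  have hm : ∀ k, MeasurableSet {x | p x k} := by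
    intro k
    by_cases h : k < M
    · have : {x | p x k} = {x | x.points ⊆ s ⟨k, h⟩} := by
        ext x; simp [p, h, h.ne]
      rw [this]
      exact PointPattern.measurableSet_subset (hs _)
    · simp only [p, h, IsEmpty.exists_iff, false_or]
      exact MeasurableSet.const _
  refine ⟨fun x => Fin.ofNat (M + 1) (Nat.find (hp x)), fun i =>
    if h : (i : ℕ) < M then Signal.ofSet T (s ⟨i, h⟩) (hs _)
    else Signal.ofSet T Set.univ MeasurableSet.univ,
    (measurable_from_nat (f := Fin.ofNat (M + 1))).comp (measurable_find hp hm), fun x => ?_⟩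
  have hval : (Fin.ofNat (M + 1) (Nat.find (hp x)) : ℕ) = Nat.find (hp x) :=
    Nat.mod_eq_of_lt (hle x)
  by_cases h : Nat.find (hp x) < M
  · have h' : (Fin.ofNat (M + 1) (Nat.find (hp x)) : ℕ) < M := by rwa [hval]
    obtain ⟨h1, h2⟩ := (Nat.find_spec (hp x)).resolve_right h.ne
    simp only [h', dif_pos]
    refine (distortion_ofSet_le hT (hs _) ?_ (hvol _)).trans le_self_add
    simpa only [hval] using h2
  · have h' : ¬ (Fin.ofNat (M + 1) (Nat.find (hp x)) : ℕ) < M := by rwa [hval]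
    simp only [h', dif_neg, not_false_eq_true]
    refine (distortion_ofSet_univ_le x).trans ?_
    rw [Set.indicator_of_mem]
    · exact le_add_self
    · intro j hj
      exact h ((Nat.find_min' (hp x) (Or.inl ⟨j.2, hj⟩)).trans_lt j.2)

/-! ### Greedy covering. -/

section Greedy

variable {α ι : Type*} [MeasurableSpace α] (ν : Measure α) [IsProbabilityMeasure ν]
  {F : Finset ι} {E : ι → Set α} {G : Set α} {q : ℝ}

open Classical in
-- Double counting: the sum over `F` of the measures of `G ∩ E i` is the integral over `G` of the
-- number of `E i` containing x, so some `i` is at least average.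
lemma exists_mul_measureReal_le (hF : F.Nonempty) (hE : ∀ i, MeasurableSet (E i))
    (hG : MeasurableSet G) (hq : ∀ x ∈ G, q * F.card ≤ (F.filter fun i => x ∈ E i).card) :
    ∃ i ∈ F, q * ν.real G ≤ ν.real (G ∩ E i) := by
  refine Finset.exists_le_of_sum_le hF ?_
  have hsum : ∑ i ∈ F, ν.real (G ∩ E i) =
      ∫ x, ∑ i ∈ F, (G ∩ E i).indicator (fun _ => (1 : ℝ)) x ∂ν := by
    rw [integral_finsetSum _ fun i _ => (integrable_const _).indicator (hG.inter (hE i))]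
    refine Finset.sum_congr rfl fun i _ => ?_
    rw [integral_indicator_const _ (hG.inter (hE i)), smul_eq_mul, mul_one]
  have hconst : ∑ _i ∈ F, q * ν.real G = ∫ x, G.indicator (fun _ => q * F.card) x ∂ν := by
    rw [integral_indicator_const _ hG, Finset.sum_const, nsmul_eq_mul, smul_eq_mul]
    ring
  rw [hsum, hconst]
  refine integral_mono ((integrable_const _).indicator hG)
    (integrable_finsetSum _ fun i _ => (integrable_const _).indicator (hG.inter (hE i)))
    fun x => ?_
  by_cases hx : x ∈ G
  · simpa [Set.indicator_apply, hx] using hq x hx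
  · simp [hx]

open Classical in
-- The averaging bound applies again to whatever is still uncovered, so each new set shrinks the
-- remainder by a factor of at most 1 - q.
lemma exists_greedy_cover (hF : F.Nonempty) (hE : ∀ i, MeasurableSet (E i))
    (hG : MeasurableSet G) (hq : ∀ x ∈ G, q * F.card ≤ (F.filter fun i => x ∈ E i).card)
    (hq1 : q ≤ 1) (M : ℕ) :
    ∃ s : Fin M → ι, (∀ j, s j ∈ F) ∧ ν.real (G \ ⋃ j, E (s j)) ≤ (1 - q) ^ M := by
  induction M with
  | zero => exact ⟨Fin.elim0, fun j => j.elim0, by simp⟩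
  | succ M ih =>
    obtain ⟨s, hsF, hs⟩ := ih
    have hmeas : MeasurableSet (G \ ⋃ j, E (s j)) :=
      hG.diff (MeasurableSet.iUnion fun j => hE _)
    obtain ⟨i, hiF, hi⟩ := exists_mul_measureReal_le ν hF hE hmeas fun x hx => hq x hx.1
    refine ⟨Fin.cons i s, Fin.cases hiF hsF, ?_⟩
    have hsplit := measureReal_inter_add_sdiff (μ := ν) (s := G \ ⋃ j, E (s j)) (hE i)
    have heq : G \ ⋃ j, E (Fin.cons (α := fun _ => ι) i s j) = (G \ ⋃ j, E (s j)) \ E i := by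
      ext x
      simp [Fin.forall_fin_succ]
      tauto
    rw [heq, pow_succ]
    have := mul_le_mul_of_nonneg_right hs (sub_nonneg.2 hq1)
    linarith

end Greedy

/-! ### Random unions of cells covering a pattern. -/

/-- The right side counts the m-subsets containing a given k-set. Its ratio to C(n, m) is a quotient
of falling factorials, at least ((m + 1 - k) / n)^k ≥ a^k ≥ a^K. -/
lemma pow_mul_choose_le_choose {n m k K : ℕ} {a : ℝ} (ha : 0 ≤ a) (ha1 : a ≤ 1) (hkK : k ≤ K)
    (hn : n ≠ 0) (hm : a * n + K ≤ m) : a ^ K * n.choose m ≤ (n - k).choose (m - k) := by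
  have hkm : k ≤ m := by
    have : (k : ℝ) ≤ m := by
      have : (k : ℝ) ≤ K := by exact_mod_cast hkK
      have : 0 ≤ a * n := by positivity
      linarith
    exact_mod_cast this
  have h1 : n.choose m * m.descFactorial k = n.descFactorial k * (n - k).choose (m - k) := by
    rw [Nat.descFactorial_eq_factorial_mul_choose, Nat.descFactorial_eq_factorial_mul_choose,
      mul_left_comm, Nat.choose_mul hkm, mul_assoc]
  have h2 : (a * n) ^ k ≤ (m.descFactorial k : ℝ) := by
    refine le_trans ?_ (Nat.cast_le.2 (Nat.pow_sub_le_descFactorial m k))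
    rw [Nat.cast_pow]
    refine pow_le_pow_left₀ (by positivity) ?_ k
    rw [Nat.cast_sub (by omega)]
    push_cast
    have : (k : ℝ) ≤ K := by exact_mod_cast hkK
    linarith
  have h3 : (n.descFactorial k : ℝ) ≤ n ^ k := by exact_mod_cast Nat.descFactorial_le_pow n k
  have hpos : (0 : ℝ) < n ^ k := by positivity
  refine le_of_mul_le_mul_left ?_ hpos
  calc (n : ℝ) ^ k * (a ^ K * n.choose m) ≤ (n : ℝ) ^ k * (a ^ k * n.choose m) := by
        gcongr ?_ * (?_ * ?_)
        exact pow_le_pow_of_le_one ha ha1 hkK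
    _ = n.choose m * (a * n) ^ k := by rw [mul_pow]; ring
    _ ≤ n.choose m * m.descFactorial k := by gcongr
    _ = n.descFactorial k * (n - k).choose (m - k) := by exact_mod_cast h1
    _ ≤ _ := by gcongr

lemma PointPattern.exists_index_set {T : ℝ} (hT : 0 < T) {n : ℕ} (hn : n ≠ 0) (x : PointPattern T)
    (h0 : x.counting 0 = 0) :
    ∃ A : Finset (Fin n), A.card ≤ x.count (Set.Ioc 0 T) ∧ x.points ⊆ cells T n A := by
  classical
  have hpos : ∀ p ∈ x.points, p ∈ Set.Ioc 0 T := fun p hp =>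
    ⟨(x.subset hp).1.lt_of_ne fun h => zero_notMem_of_counting_zero h0 (h ▸ hp), (x.subset hp).2⟩
  have : NeZero n := ⟨hn⟩
  have hex : ∀ p : ℝ, ∃ i : Fin n, p ∈ Set.Ioc 0 T → p ∈ cell T n i := by
    intro p
    by_cases hp : p ∈ Set.Ioc 0 T
    · obtain ⟨i, hi⟩ := exists_mem_cell hT hn hp
      exact ⟨i, fun _ => hi⟩
    · exact ⟨0, fun h => absurd h hp⟩
  choose f hf using hex
  refine ⟨x.finite.toFinset.image f, ?_, fun p hp => ?_⟩
  · refine Finset.card_image_le.trans (le_of_eq ?_)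
    rw [← Set.ncard_eq_toFinset_card _ x.finite, count, Set.inter_eq_left.2 hpos]
  · refine Set.mem_iUnion₂.2 ⟨f p, ?_, hf p (hpos p hp)⟩
    exact Finset.mem_image_of_mem f (by simpa using hp)

lemma exists_covering_sets {T D δ : ℝ} (hT : 0 < T) (hD : 0 < D) (hδ : 0 < δ) (hδ' : D + δ ≤ 1)
    (ν : Measure (PointPattern T)) [IsProbabilityMeasure ν] (K M : ℕ) :
    ∃ s : Fin M → Set ℝ, (∀ j, MeasurableSet (s j)) ∧
      (∀ j, volume (s j) ≤ ENNReal.ofReal ((D + δ) * T)) ∧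
      ν.real ({x | x.count (Set.Ioc 0 T) ≤ K ∧ x.counting 0 = 0} \ ⋃ j, {x | x.points ⊆ s j}) ≤
        (1 - D ^ K) ^ M := by
  classical
  -- With m = ⌈D n⌉ + K, the slack δ n must absorb K and the 1 lost in rounding up.
  obtain ⟨n, hn⟩ := exists_nat_ge ((K + 1) / δ)
  have hK : (K : ℝ) + 1 ≤ δ * n := by rwa [div_le_iff₀' hδ] at hn
  have hn0 : n ≠ 0 := by
    rintro rfl
    have : (0 : ℝ) ≤ K := by positivity
    simp at hK
    linarith
  have hnpos : (0 : ℝ) < n := by positivity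
  obtain ⟨m, rfl⟩ : ∃ m, m = ⌈D * n⌉₊ + K := ⟨_, rfl⟩
  have hm₁ : D * n + K ≤ (⌈D * n⌉₊ + K : ℕ) := by
    push_cast
    linarith [Nat.le_ceil (D * n)]
  have hm₂ : ((⌈D * n⌉₊ + K : ℕ) : ℝ) ≤ (D + δ) * n := by
    push_cast
    linarith [Nat.ceil_lt_add_one (show 0 ≤ D * n by positivity)]
  generalize ⌈D * n⌉₊ + K = m at hm₁ hm₂
  have hmn : m ≤ n := by
    have : (m : ℝ) ≤ n := hm₂.trans (by nlinarith)
    exact_mod_cast this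
  let F : Finset (Finset (Fin n)) := Finset.powersetCard m Finset.univ
  have hFcard : F.card = n.choose m := by simp [F]
  have hFne : F.Nonempty := by
    rw [← Finset.card_pos, hFcard]
    exact Nat.choose_pos hmn
  have hG : MeasurableSet {x : PointPattern T | x.count (Set.Ioc 0 T) ≤ K ∧ x.counting 0 = 0} :=
    (PointPattern.measurable_count measurableSet_Ioc (measurableSet_Iic (a := K))).inter
      (PointPattern.measurable_count measurableSet_Icc (measurableSet_singleton 0))
  obtain ⟨s, hsF, hs⟩ := exists_greedy_cover ν (F := F)
    (E := fun S => {x : PointPattern T | x.points ⊆ cells T n S}) (q := D ^ K) hFne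
    (fun S => PointPattern.measurableSet_subset (measurableSet_cells S)) hG
    (by
      rintro x ⟨hxK, hx0⟩
      obtain ⟨A, hA, hxA⟩ := x.exists_index_set hT hn0 hx0
      have hAK := hA.trans hxK
      have hAm : A.card ≤ m := by
        have h1 : (A.card : ℝ) ≤ K := by exact_mod_cast hAK
        have h2 : 0 ≤ D * n := by positivity
        have : (A.card : ℝ) ≤ m := by linarith
        exact_mod_cast this
      have hcard := Finset.card_filter_powersetCard_subset A Finset.univ m (Finset.subset_univ _) hAm
      rw [Finset.card_univ, Fintype.card_fin] at hcard
      rw [hFcard]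
      refine (pow_mul_choose_le_choose hD.le (by linarith) hAK hn0 hm₁).trans ?_
      rw [← hcard, Nat.cast_le]
      refine Finset.card_le_card (Finset.monotone_filter_right _ fun S _ hAS => ?_)
      exact hxA.trans (Set.biUnion_subset_biUnion_left hAS))
    (pow_le_one₀ hD.le (by linarith)) M
  refine ⟨fun j => cells T n (s j), fun j => measurableSet_cells _, fun j => ?_, hs⟩
  rw [volume_cells hT, (Finset.mem_powersetCard.1 (hsF j)).2]
  refine ENNReal.ofReal_le_ofReal ?_
  calc (m : ℝ) * (T / n) ≤ (D + δ) * n * (T / n) := by gcongr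
    _ = _ := by field_simp

/-! ### Achievability: expected distortion and choice of parameters. -/

namespace IsPoissonProcess

variable {Ω : Type*} [MeasurableSpace Ω] {P : Measure Ω} {lam T : ℝ} {X : Ω → PointPattern T}

lemma exists_code [IsProbabilityMeasure P] (hX : IsPoissonProcess P lam T X)
    (hT : 0 < T) {D δ r : ℝ} (hD : 0 < D) (hδ : 0 < δ) (hδ' : D + δ ≤ 1) (K : ℕ) (hr : 1 ≤ ⌊(2 : ℝ) ^ (T * r)⌋₊) :
    ∃ C : Code T r, ∫⁻ ω, distortion (X ω) (C.reconstruct (C.encode (X ω))) ∂P ≤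
      ENNReal.ofReal (D + δ + (1 - D ^ K) ^ (⌊(2 : ℝ) ^ (T * r)⌋₊ - 1) +
        P.real {ω | K < (X ω).count (Set.Ioc 0 T)}) := by
  have hprob : IsProbabilityMeasure (P.map X) :=
    Measure.isProbabilityMeasure_map hX.measurable.aemeasurable
  obtain ⟨s, hs, hvol, hcov⟩ := exists_covering_sets hT hD hδ hδ' (P.map X) K
    (⌊(2 : ℝ) ^ (T * r)⌋₊ - 1)
  obtain ⟨e, φ, he, hdist⟩ := exists_encoder hT (Nat.sub_add_cancel hr).symm s hs hvol
  have hfail : MeasurableSet {x : PointPattern T | ∀ j, ¬ x.points ⊆ s j} := by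
    rw [Set.ofPred_forall]
    exact MeasurableSet.iInter fun j => (PointPattern.measurableSet_subset (hs j)).compl
  have hGm : MeasurableSet
      ({x : PointPattern T | x.count (Set.Ioc 0 T) ≤ K ∧ x.counting 0 = 0} \
        ⋃ j, {x | x.points ⊆ s j}) :=
    ((PointPattern.measurable_count measurableSet_Ioc (measurableSet_Iic (a := K))).inter
      (PointPattern.measurable_count measurableSet_Icc (measurableSet_singleton 0))).diff
      (MeasurableSet.iUnion fun j => PointPattern.measurableSet_subset (hs j))
  rw [map_measureReal_apply hX.measurable hGm] at hcov
  refine ⟨⟨e, he, φ⟩, (lintegral_mono fun ω => hdist (X ω)).trans ?_⟩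
  have hfail' : P.real (X ⁻¹' {x : PointPattern T | ∀ j, ¬ x.points ⊆ s j}) ≤
      (1 - D ^ K) ^ (⌊(2 : ℝ) ^ (T * r)⌋₊ - 1) + P.real {ω | K < (X ω).count (Set.Ioc 0 T)} := by
    refine le_trans ?_ (add_le_add_left hcov _)
    refine le_trans ?_ (measureReal_union_le _ _)
    refine ENNReal.toReal_mono (measure_ne_top _ _) (measure_mono_ae ?_)
    filter_upwards [hX.counting_zero] with ω hω hfω
    by_cases hK : K < (X ω).count (Set.Ioc 0 T)
    · exact Or.inr hK
    · refine Or.inl ⟨⟨not_lt.1 hK, hω⟩, ?_⟩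
      have : ∀ j, ¬ (X ω).points ⊆ s j := hfω
      simpa using this
  have hD1 : D ^ K ≤ 1 := pow_le_one₀ hD.le (by linarith)
  rw [lintegral_add_left measurable_const, lintegral_const, measure_univ, mul_one, add_assoc,
    ENNReal.ofReal_add (by positivity)
      (add_nonneg (pow_nonneg (sub_nonneg.2 hD1) _) measureReal_nonneg)]
  gcongr
  refine le_trans (le_of_eq ?_) (ENNReal.ofReal_le_ofReal hfail')
  rw [ofReal_measureReal, ← lintegral_indicator_one (hX.measurable hfail)]
  rfl

/-- Chernoff bound: Markov's inequality for (a / lam)^N, the optimal base. -/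
lemma measureReal_lt_count_le (hX : IsPoissonProcess P lam T X) (hlam : 0 < lam) (hT : 0 < T)
    {a : ℝ} (ha : lam < a) :
    P.real {ω | ⌊a * T⌋₊ < (X ω).count (Set.Ioc 0 T)} ≤
      Real.exp (T * (a - lam - a * Real.log (a / lam))) := by
  have ha0 : 0 < a := hlam.trans ha
  have hc : 1 < a / lam := (one_lt_div hlam).2 ha
  have hc0 : 0 < a / lam := by positivity
  have hm : AEMeasurable (fun ω => ENNReal.ofReal ((a / lam) ^ (X ω).count (Set.Ioc 0 T))) P :=
    (ENNReal.measurable_ofReal.comp (measurable_from_nat.comp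
      (hX.measurable_count measurableSet_Ioc))).aemeasurable
  have hmarkov := meas_ge_le_lintegral_div hm
    (ENNReal.ofReal_pos.2 (Real.rpow_pos_of_pos hc0 (a * T))).ne' ENNReal.ofReal_ne_top
  rw [hX.lintegral_pow_count_Ioc hlam le_rfl hT.le le_rfl hc0.le,
    ← ENNReal.ofReal_div_of_pos (Real.rpow_pos_of_pos hc0 _)] at hmarkov
  refine ENNReal.toReal_le_of_le_ofReal (Real.exp_pos _).le ?_
  refine (measure_mono fun ω hω => ?_).trans (hmarkov.trans (ENNReal.ofReal_le_ofReal ?_))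
  · refine ENNReal.ofReal_le_ofReal ?_
    rw [← Real.rpow_natCast]
    exact Real.rpow_le_rpow_of_exponent_le hc.le ((Nat.floor_lt (by positivity)).1 hω).le
  · rw [Real.rpow_def_of_pos hc0, ← Real.exp_sub, Real.exp_le_exp]
    refine le_of_eq ?_
    field_simp
    ring

end IsPoissonProcess

theorem isAchievable_of_one_le {Ω : ℝ → Type*} [∀ T, MeasurableSpace (Ω T)]
    {P : ∀ T, Measure (Ω T)} [∀ T, IsProbabilityMeasure (P T)] {X : ∀ T, Ω T → PointPattern T}
    {D : ℝ} (hD : 1 ≤ D) : IsAchievable P X 0 D := by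
  refine fun ε hε => ⟨1, one_pos, fun T hT => ?_⟩
  have hpos : 0 < ⌊(2 : ℝ) ^ (T * (0 + ε))⌋₊ := by
    rw [Nat.floor_pos]
    exact Real.one_le_rpow one_le_two (mul_nonneg (by linarith) (by linarith))
  refine ⟨⟨fun _ => ⟨0, hpos⟩, measurable_const,
    fun _ => Signal.ofSet T Set.univ MeasurableSet.univ⟩, ?_⟩
  refine (lintegral_mono fun ω => distortion_ofSet_univ_le (X T ω)).trans ?_
  rw [lintegral_const, measure_univ, mul_one, ENNReal.one_le_ofReal]
  linarith

theorem isAchievable_of_lt_one {Ω : ℝ → Type*} [∀ T, MeasurableSpace (Ω T)]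
    {P : ∀ T, Measure (Ω T)} [∀ T, IsProbabilityMeasure (P T)] {X : ∀ T, Ω T → PointPattern T}
    {D lam : ℝ} (hD : 0 < D) (hlam : 0 < lam)
    (hX : ∀ T, 0 < T → IsPoissonProcess (P T) lam T (X T)) (hD1 : D < 1) :
    IsAchievable P X (-lam * Real.logb 2 D) D := by
  intro ε hε
  have hlog2 : 0 < Real.log 2 := Real.log_pos one_lt_two
  have hL : Real.log D < 0 := Real.log_neg hD hD1
  -- Half of the extra rate ε, in nats, pays for raising lam to `a`: D^(a T) = exp(T (lam log D -
  -- κ)). The other half leaves 2^(T r) D^(a T) = exp(T κ).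
  let κ : ℝ := ε * Real.log 2 / 2
  have hκ : 0 < κ := by positivity
  let a : ℝ := lam + κ / -Real.log D
  have ha : lam < a := lt_add_of_pos_right _ (div_pos hκ (neg_pos.2 hL))
  have ha0 : 0 < a := hlam.trans ha
  have haL : a * Real.log D = lam * Real.log D - κ := by
    simp only [a]
    field_simp [hL.ne]
    ring
  have hβ : a - lam - a * Real.log (a / lam) < 0 := by
    have h1 : lam / a ≠ 1 := ((div_lt_one ha0).2 ha).ne
    have h2 := mul_lt_mul_of_pos_left (Real.log_lt_sub_one_of_pos (by positivity) h1) ha0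
    rw [← inv_div a lam, Real.log_inv, inv_div, mul_sub, mul_div_cancel₀ _ ha0.ne'] at h2
    linarith
  let δ : ℝ := min (ε / 2) (1 - D)
  have hδ : 0 < δ := lt_min (by linarith) (by linarith)
  have hδ₁ : δ ≤ ε / 2 := min_le_left _ _
  have hδ₂ : D + δ ≤ 1 := by linarith [min_le_right (ε / 2) (1 - D)]
  have hlim₁ : Tendsto (fun T : ℝ => Real.exp (2 - Real.exp (T * κ))) atTop (𝓝 0) := by
    refine Real.tendsto_exp_atBot.comp (tendsto_atBot_add_const_left _ 2 ?_ |>.congr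
      fun T => (sub_eq_add_neg _ _).symm)
    exact tendsto_neg_atTop_atBot.comp (Real.tendsto_exp_atTop.comp
      (tendsto_id.atTop_mul_const hκ))
  have hlim₂ : Tendsto (fun T : ℝ => Real.exp (T * (a - lam - a * Real.log (a / lam)))) atTop
      (𝓝 0) := Real.tendsto_exp_atBot.comp (tendsto_id.atTop_mul_const_of_neg hβ)
  have hlim := hlim₁.add hlim₂
  rw [add_zero] at hlim
  obtain ⟨T₀, hT₀⟩ := eventually_atTop.1 (hlim.eventually (gt_mem_nhds (half_pos hε)))
  refine ⟨max T₀ 1, by positivity, fun T hT => ?_⟩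
  have hT0 : 0 < T := zero_lt_one.trans ((le_max_right _ _).trans_lt hT)
  have hsmall := hT₀ T ((le_max_left _ _).trans hT.le)
  let r : ℝ := -lam * Real.logb 2 D + ε
  have hrpow : (2 : ℝ) ^ (T * r) = Real.exp (T * (-(lam * Real.log D) + 2 * κ)) := by
    rw [Real.rpow_def_of_pos two_pos]
    congr 1
    simp only [r, κ, Real.logb]
    field_simp
  have hfloor : 1 ≤ ⌊(2 : ℝ) ^ (T * r)⌋₊ := by
    rw [Nat.one_le_floor_iff, hrpow, Real.one_le_exp_iff]
    have : lam * Real.log D < 0 := mul_neg_of_pos_of_neg hlam hL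
    exact mul_nonneg hT0.le (by linarith)
  obtain ⟨C, hC⟩ := (hX T hT0).exists_code hT0 hD hδ hδ₂ ⌊a * T⌋₊ hfloor
  refine ⟨C, hC.trans (ENNReal.ofReal_le_ofReal ?_)⟩
  have hcount := (hX T hT0).measureReal_lt_count_le hlam hT0 ha
  have hq1 : D ^ ⌊a * T⌋₊ ≤ 1 := pow_le_one₀ hD.le hD1.le
  have hq : Real.exp (T * (lam * Real.log D - κ)) ≤ D ^ ⌊a * T⌋₊ := by
    rw [← haL, ← Real.rpow_natCast, Real.rpow_def_of_pos hD, Real.exp_le_exp]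
    have := Nat.floor_le (show 0 ≤ a * T by positivity)
    nlinarith
  -- One unit is lost to the floor, the other to the message reserved for uncovered patterns.
  have hM : (2 : ℝ) ^ (T * r) - 2 ≤ ((⌊(2 : ℝ) ^ (T * r)⌋₊ - 1 : ℕ) : ℝ) := by
    rw [Nat.cast_sub hfloor, Nat.cast_one]
    linarith [Nat.lt_floor_add_one ((2 : ℝ) ^ (T * r))]
  have hprod : Real.exp (T * κ) - 2 ≤ D ^ ⌊a * T⌋₊ * ((⌊(2 : ℝ) ^ (T * r)⌋₊ - 1 : ℕ) : ℝ) := by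
    have h1 : Real.exp (T * κ) = Real.exp (T * (lam * Real.log D - κ)) * (2 : ℝ) ^ (T * r) := by
      rw [hrpow, ← Real.exp_add]
      congr 1
      ring
    have h2 := mul_le_mul_of_nonneg_right hq (show 0 ≤ (2 : ℝ) ^ (T * r) by positivity)
    have h3 := mul_le_mul_of_nonneg_left hM (show 0 ≤ D ^ ⌊a * T⌋₊ by positivity)
    linarith
  have hpow : (1 - D ^ ⌊a * T⌋₊) ^ (⌊(2 : ℝ) ^ (T * r)⌋₊ - 1) ≤
      Real.exp (2 - Real.exp (T * κ)) := by
    refine (pow_le_pow_left₀ (sub_nonneg.2 hq1) (Real.one_sub_le_exp_neg _) _).trans ?_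
    rw [← Real.exp_nat_mul, Real.exp_le_exp]
    linarith
  linarith

end PoissonCovering

theorem mainTheorem1 {Ω : ℝ → Type*} [∀ T, MeasurableSpace (Ω T)] (P : ∀ T, Measure (Ω T))
    [∀ T, IsProbabilityMeasure (P T)] (X : ∀ T, Ω T → PoissonCovering.PointPattern T)
    (D lam : ℝ) (hD : 0 < D) (hlam : 0 < lam)
    (hX : ∀ T, 0 < T → PoissonCovering.IsPoissonProcess (P T) lam T (X T)) :
    IsLeast {R : ℝ | PoissonCovering.IsAchievable P X R D}
      (PoissonCovering.poissonRate D lam) := by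
  refine ⟨?_, fun R hR => PoissonCovering.poissonRate_le_of_isAchievable hD hlam hX hR⟩
  rw [Set.mem_ofPred_eq, PoissonCovering.poissonRate]
  split_ifs with h
  · exact PoissonCovering.isAchievable_of_lt_one hD hlam hX h
  · exact PoissonCovering.isAchievable_of_one_le (not_lt.1 h)
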